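/- All rings $R,S$ below are commutative. A commutative ring is coherent if its finitely generated ideals are finitely presented. Let $\theta\colon R\to S$ be a surjective homomorphism between coherent commutative rings such that $S$ is a finitely presented $R$-module and $\ker\theta$ is nilpotent. For an abelian $R$-linear category $\mathcal C$, let $\mathcal C_S$ be the category of pairs $(X,\varphi)$ with $X\in\mathcal C$ and $\varphi\colon S\to\mathcal C(X,X)$ a ring map such that $\varphi(\theta(r))=r\cdot 1_X$ for all $r\in R$; its morphisms are the morphisms of $\mathcal C$ compatible with the $S$-actions. A nilpotent $R$-deformation of an abelian $S$-linear category $\mathcal D$ is an abelian $R$-linear category $\mathcal C$ with a functor $F\colon\mathcal D\to\mathcal C$ that is $R$-linear (where $R$ acts on $\mathcal D$ through $\theta$) and induces an equivalence $\mathcal D\to\mathcal C_S$, $Y\mapsto(F(Y),\,s\mapsto F(s\cdot 1_Y))$. The deformation is flat if $\mathcal C$ is flat over $R$, that is: for every finitely presented $R$-module $M$, all $A,B\in\mathcal C$ and every $x\in\operatorname{Ext}^1_R(M,\mathcal C(A,B))$ there are an epimorphism $A'\to A$ and a monomorphism $B\to B'$ in $\mathcal C$ such that $x$ is mapped to $0$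 in $\operatorname{Ext}^1_R(M,\mathcal C(A',B'))$. **Theorem.** Let $\mathcal D\to\mathcal C$ be a flat nilpotent $R$-deformation of abelian categories. If $\mathcal D$ has enough injectives, then so does $\mathcal C$. This fails without flatness: for every field $k$, the map $\theta\colon k[\epsilon]\to k$, $\epsilon\mapsto0$ (with $\epsilon^2=0$) satisfies the hypotheses above, the category $\operatorname{Mod}(k)$ has enough injectives, and there is a nilpotent $k[\epsilon]$-deformation $\operatorname{Mod}(k)\to\mathcal C$ with $\mathcal C$ abelian such that $\mathcal C$ is not flat over $k[\epsilon]$ and does not have enough injectives. -/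

import Mathlib

open CategoryTheory

universe w v v₁ v₂ u u₁ u₂

noncomputable section

namespace AbelianDeformation

/-- A commutative ring is coherent if every finitely generated ideal is finitely presented. -/
class IsCoherentRing (R : Type u) [CommRing R] : Prop where
  finitePresentation_of_fg : ∀ I : Ideal R, I.FG → Module.FinitePresentation R I

/-- The standing assumptions on the base change `θ : R → S` for nilpotent deformations: the
commutative rings `R` and `S` are coherent, `S` is finitely presented as an `R`-module through `θ`,
and `θ` is surjective with nilpotent kernel. -/
structure IsNilpotentThickening {R : Type u₁} {S : Type u₂} [CommRing R] [CommRing S]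
    (θ : R →+* S) : Prop where
  coherent_source : IsCoherentRing R
  coherent_target : IsCoherentRing S
  finitePresentation : letI : Module R S := Module.compHom S θ; Module.FinitePresentation R S
  surjective : Function.Surjective θ
  isNilpotent_ker : IsNilpotent (RingHom.ker θ)

section SObjects

variable {R : Type w} {S : Type u} [CommRing R] [CommRing S] (θ : R →+* S)
variable (C : Type u₁) [Category.{v₁} C] [Preadditive C] [Linear R C]

/-- An `S`-object of the `R`-linear category `C`: an object `X` of `C` together with a ring map
`φ : S → C(X, X)` such that `φ ∘ θ` is the given action of `R` on `X`. -/
structure SObject where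
  /-- the underlying object -/
  X : C
  /-- the action of `S` -/
  φ : S →+* End X
  φ_comp : ∀ r : R, (φ (θ r) : X ⟶ X) = r • 𝟙 X

namespace SObject

variable {θ C}

/-- A morphism of `S`-objects is a morphism of `C` that is compatible with the actions of `S`. -/
@[ext]
structure Hom (A B : SObject θ C) where
  /-- the underlying morphism -/
  hom : A.X ⟶ B.X
  comm : ∀ s : S, (A.φ s : A.X ⟶ A.X) ≫ hom = hom ≫ (B.φ s : B.X ⟶ B.X)

/-- The category `C_S` of `S`-objects in `C`. -/
instance : Category (SObject θ C) where
  Hom A B := Hom A B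
  id A := { hom := 𝟙 A.X, comm := fun s => by rw [Category.comp_id, Category.id_comp] }
  comp f g :=
    { hom := f.hom ≫ g.hom
      comm := fun s => by
        rw [← Category.assoc, f.comm, Category.assoc, g.comm, Category.assoc] }
  id_comp f := Hom.ext (Category.id_comp _)
  comp_id f := Hom.ext (Category.comp_id _)
  assoc f g h := Hom.ext (Category.assoc _ _ _)

variable {D : Type u₂} [Category.{v₂} D] [Preadditive D] [Linear S D]

/-- The functor `D ⥤ C_S` induced by an `R`-linear functor `F : D ⥤ C`, where the `S`-linear
category `D` is regarded as an `R`-linear category through `θ`. It sends `Y` to `F Y`, on which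
`s : S` acts by `F (s • 𝟙 Y)`. -/
def lift (F : D ⥤ C) (hadd : F.Additive)
    (hsmul : ∀ ⦃X Y : D⦄ (f : X ⟶ Y) (r : R), F.map (θ r • f) = r • F.map f) :
    D ⥤ SObject θ C where
  obj Y :=
    { X := F.obj Y
      φ :=
        { toFun := fun s => F.map (s • 𝟙 Y)
          map_one' := by rw [one_smul, F.map_id]; rfl
          map_mul' := fun s t => by
            rw [End.mul_def, ← F.map_comp, Linear.smul_comp, Category.id_comp, smul_smul, mul_comm]
          map_zero' := by rw [zero_smul]; exact F.map_zero _ _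
          map_add' := fun s t => by rw [add_smul]; exact F.map_add }
      φ_comp := fun r => by
        change F.map (θ r • 𝟙 Y) = r • 𝟙 (F.obj Y)
        rw [hsmul, F.map_id] }
  map {Y Z} f :=
    { hom := F.map f
      comm := fun s => by
        change F.map (s • 𝟙 Y) ≫ F.map f = F.map f ≫ F.map (s • 𝟙 Z)
        rw [← F.map_comp, ← F.map_comp, Linear.smul_comp, Linear.comp_smul, Category.id_comp,
          Category.comp_id] }
  map_id Y := Hom.ext (F.map_id Y)
  map_comp f g := Hom.ext (F.map_comp f g)

end SObject

end SObjects

/-- Let `D` be an `S`-linear and `C` an `R`-linear category. The functor `F : D ⥤ C` makes `C` an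
`R`-deformation of `D` along `θ : R → S` if it is `R`-linear (for the `R`-linear structure on `D`
that `θ` induces) and if the induced functor `D ⥤ C_S` is an equivalence of categories. -/
structure IsDeformation {R : Type w} {S : Type u} [CommRing R] [CommRing S] (θ : R →+* S)
    {C : Type u₁} [Category.{v₁} C] [Abelian C] [Linear R C]
    {D : Type u₂} [Category.{v₂} D] [Abelian D] [Linear S D] (F : D ⥤ C) : Prop where
  additive : F.Additive
  map_smul : ∀ ⦃X Y : D⦄ (f : X ⟶ Y) (r : R), F.map (θ r • f) = r • F.map f
  isEquivalence : (SObject.lift F additive map_smul).IsEquivalence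

/-- A functor `F : A ⥤ Ab` is weakly effaceable if every element `x` of every `F(X)` is annihilated
by `F(i)` for some monomorphism `i : X ⟶ Y`. -/
def WeaklyEffaceable {A : Type u₁} [Category.{v₁} A] (F : A ⥤ AddCommGrpCat.{w}) : Prop :=
  ∀ (X : A) (x : F.obj X), ∃ (Y : A) (i : X ⟶ Y), Mono i ∧ F.map i x = 0

/-- The bifunctor `Ext¹_R(M, C(-, -)) : Cᵒᵖ × C ⥤ Ab`, for an `R`-module `M` and an `R`-linear
category `C`. -/
def extOneHom (R : Type v) [CommRing R] (C : Type u) [Category.{v} C] [Preadditive C] [Linear R C]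
    (M : ModuleCat.{v} R) : Cᵒᵖ × C ⥤ AddCommGrpCat.{v} :=
  Functor.uncurry.obj (linearCoyoneda R C) ⋙ Abelian.extFunctorObj M 1

/-- The abelian `R`-linear category `C` is flat over `R` if for every finitely presented `R`-module
`M` the functor `Ext¹_R(M, C(-, -)) : Cᵒᵖ × C ⥤ Ab` is weakly effaceable. (A monomorphism in
`Cᵒᵖ × C` is a pair consisting of an epimorphism `A' ⟶ A` and a monomorphism `B ⟶ B'` of `C`.) -/
def IsFlat (R : Type v) [CommRing R] (C : Type u) [Category.{v} C] [Abelian C] [Linear R C] : Prop :=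
  ∀ M : ModuleCat.{v} R, Module.FinitePresentation R M → WeaklyEffaceable (extOneHom R C M)

end AbelianDeformation

end

/-!
# Injectives in flat nilpotent deformations

Let `I = ker θ`. The deformation identifies `D` with the full subcategory of `C` on the objects
annihilated by `I`, called `I`-torsion here, and coherence of `R` makes `Hom_R(I, X)` an object of
`C` for every `X` in `C`.

An object `X` of `C` is injective as soon as its annihilator `Hom_R(R/I, X)` is injective among
`I`-torsion objects and the canonical map `X ⟶ Hom_R(I, X)` is an epimorphism
(`injective_of_isAnnihilator`). Indeed, if `B / A` is killed by `I`, then multiplication sends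
an element of `B` to a map `I → A`; composed with `A ⟶ X`, this map is multiplication on an element
of `X`, and the difference of the two elements, taken in the pushout, is annihilated by `I`. The
case of a general quotient `B / A` follows by nilpotency.

Starting from an injective `E` of `D`, such an `X` with annihilator `E` is built in finitely many
steps (`IsFlat.exists_enlargement`, `IsFlat.exists_approximation`). In each step flatness, applied
to `R / I` and the class in `Ext¹_R(R/I, C(Hom_R(I, X), X))` of the universal map, provides an
overobject of `X` in which the universal map `I → C(Hom_R(I, X), X)` becomes, locally, multiplication
on an element; injectivity of `E` allows one to divide out the excess annihilator. Since `I` is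
nilpotent the process stops. Finally, an object of `C` embeds into an injective object because its
annihilator does (`mono_of_isAnnihilator`). All diagram chases use generalized elements `T ⟶ X` up
to epimorphic refinement.

Without flatness, consider the `k[ε]`-modules `X` with `ε X` finite-dimensional. They form an abelian
category whose `ε`-torsion objects are all the vector spaces. An injective object `J` containing a
vector space `V` satisfies `V ⊆ ε J`, which is impossible if `V` is infinite-dimensional
(`not_enoughInjectives_finiteEps`); by the first part this category is not flat.
-/

noncomputable section

namespace AbelianDeformation

open Limits
open scoped Prod

/-! ### Annihilators and objects of homomorphisms in a linear abelian category -/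

section LinearAbelian

variable {R : Type w} [CommRing R] {C : Type u} [Category.{v} C] [Abelian C] [Linear R C]

/-- A morphism that factors through a monomorphism `j` after precomposition with an epimorphism
factors through `j`. -/
lemma exists_factor_of_epi_comp {T T' X Y : C} {p : T' ⟶ T} [Epi p] {j : X ⟶ Y} [Mono j]
    {x : T ⟶ Y} {y : T' ⟶ X} (h : y ≫ j = p ≫ x) : ∃ z : T ⟶ X, z ≫ j = x := by
  have := strongEpi_of_epi p
  have sq : CommSq y p j x := ⟨h⟩
  exact ⟨sq.lift, sq.fac_right⟩

/-- The object `H = Hom_R(M, X)` of `C` for a finitely presented module `M`, with its universal linear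
family `M → C(H, X)`: every linear family `M → C(T, X)` is induced by a morphism `T ⟶ H`. The
uniqueness of that morphism is not recorded. -/
lemma exists_homObject (M : Type*) [AddCommGroup M] [Module R M] [Module.FinitePresentation R M]
    (X : C) :
    ∃ (H : C) (h : M →ₗ[R] (H ⟶ X)), ∀ (T : C) (g : M →ₗ[R] (T ⟶ X)),
      ∃ t : T ⟶ H, ∀ m, t ≫ h m = g m := by
  have : HasFiniteBiproducts C := Abelian.hasFiniteBiproducts
  obtain ⟨n, m, f, g, hf, hgf⟩ := Module.FinitePresentation.exists_fin' R M
  -- `Hom_R(M, X)` is the kernel of the map `Xⁿ ⟶ Xᵐ` induced by the presentation `Rᵐ → Rⁿ → M`.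
  let d : (⨁ fun _ : Fin n => X) ⟶ (⨁ fun _ : Fin m => X) :=
    biproduct.lift fun k => ∑ j, (g (Pi.single k 1) j) • biproduct.π (fun _ : Fin n => X) j
  have hcomb : ∀ {T : C} (a : Fin n → (T ⟶ X)) (k : Fin m),
      biproduct.lift a ≫ d ≫ biproduct.π (fun _ : Fin m => X) k =
        Fintype.linearCombination R a (g (Pi.single k 1)) := by
    intro T a k
    simp [d, Fintype.linearCombination_apply, Preadditive.comp_sum]
  let a₀ : Fin n → (kernel d ⟶ X) := fun j => kernel.ι d ≫ biproduct.π (fun _ : Fin n => X) j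
  have ha₀ : LinearMap.ker f ≤ LinearMap.ker (Fintype.linearCombination R a₀) := by
    have hz : Fintype.linearCombination R a₀ ∘ₗ g = 0 := by
      refine LinearMap.pi_ext' fun k => LinearMap.ext_ring ?_
      have := hcomb a₀ k
      have hl : biproduct.lift a₀ = kernel.ι d := by ext; simp [a₀]
      rw [hl, kernel.condition_assoc, zero_comp] at this
      simpa using this.symm
    intro c hc
    obtain ⟨b, rfl⟩ := (hgf c).1 hc
    exact LinearMap.congr_fun hz b
  let h : M →ₗ[R] (kernel d ⟶ X) := (LinearMap.ker f).liftQ _ ha₀ ∘ₗ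
    (f.quotKerEquivOfSurjective hf).symm.toLinearMap
  have hh : ∀ c, h (f c) = Fintype.linearCombination R a₀ c := by
    intro c
    have : (f.quotKerEquivOfSurjective hf).symm (f c) = Submodule.Quotient.mk c := by
      rw [LinearEquiv.symm_apply_eq]; rfl
    simp only [h, LinearMap.comp_apply, LinearEquiv.coe_coe, this]
    exact Submodule.liftQ_apply _ _ _
  refine ⟨kernel d, h, fun T φ => ?_⟩
  let a : Fin n → (T ⟶ X) := fun j => φ (f (Pi.single j 1))
  have hφ : ∀ c, Fintype.linearCombination R a c = φ (f c) := by
    have : Fintype.linearCombination R a = φ ∘ₗ f := by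
      refine LinearMap.pi_ext' fun k => LinearMap.ext_ring ?_
      simp [a]
    exact fun c => LinearMap.congr_fun this c
  refine ⟨kernel.lift d (biproduct.lift a) ?_, fun x => ?_⟩
  · refine biproduct.hom_ext _ _ fun k => ?_
    rw [Category.assoc, hcomb, hφ, (hgf _).2 ⟨_, rfl⟩, map_zero, zero_comp]
  · obtain ⟨c, rfl⟩ := hf x
    rw [hh, ← hφ]
    simp [Fintype.linearCombination_apply, Preadditive.comp_sum, a₀]

/-- For a morphism `π : B ⟶ Q` and a finitely generated ideal `I`, there is a largest subobject of
`B` whose image in `Q` is annihilated by `I`. -/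
lemma exists_relative_annihilator {I : Ideal R} (hI : I.FG) {B Q : C} (π : B ⟶ Q) :
    ∃ (B' : C) (ι : B' ⟶ B), Mono ι ∧ (∀ i ∈ I, i • (ι ≫ π) = 0) ∧
      ∀ (T : C) (x : T ⟶ B), (∀ i ∈ I, i • (x ≫ π) = 0) → ∃ y : T ⟶ B', y ≫ ι = x := by
  have : HasFiniteBiproducts C := Abelian.hasFiniteBiproducts
  obtain ⟨n, a, rfl⟩ := Submodule.fg_iff_exists_fin_generating_family.1 hI
  let d : B ⟶ ⨁ fun _ : Fin n => Q := biproduct.lift fun j => a j • π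
  refine ⟨kernel d, kernel.ι d, inferInstance, fun i hi => ?_, fun T x hx => ?_⟩
  · induction hi using Submodule.span_induction with
    | mem i hi =>
      obtain ⟨j, rfl⟩ := hi
      have : kernel.ι d ≫ d ≫ biproduct.π _ j = 0 := by rw [kernel.condition_assoc, zero_comp]
      simpa only [d, biproduct.lift_π, Linear.comp_smul] using this
    | zero => simp
    | add i j _ _ hi hj => rw [add_smul, hi, hj, add_zero]
    | smul r i _ hi => rw [smul_eq_mul, mul_smul, hi, smul_zero]
  · refine ⟨kernel.lift d x ?_, kernel.lift_ι _ _ _⟩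
    refine biproduct.hom_ext _ _ fun j => ?_
    simpa [d] using hx (a j) (Submodule.subset_span ⟨j, rfl⟩)

/-- An object of `C` is `I`-torsion if it is annihilated by the ideal `I`. -/
def IsTorsionObject (I : Ideal R) (X : C) : Prop :=
  ∀ i ∈ I, i • 𝟙 X = 0

lemma IsTorsionObject.smul_comp {I : Ideal R} {X Y : C} (hX : IsTorsionObject I X) (f : X ⟶ Y)
    {i : R} (hi : i ∈ I) : i • f = 0 := by
  rw [← Category.id_comp f, ← Linear.smul_comp, hX i hi, zero_comp]

lemma IsTorsionObject.comp_smul {I : Ideal R} {X Y : C} (hY : IsTorsionObject I Y) (f : X ⟶ Y)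
    {i : R} (hi : i ∈ I) : i • f = 0 := by
  rw [← Category.comp_id f, ← Linear.comp_smul, hY i hi, comp_zero]

lemma IsTorsionObject.of_mono {I : Ideal R} {X Y : C} (hY : IsTorsionObject I Y) (f : X ⟶ Y)
    [Mono f] : IsTorsionObject I X := fun i hi => by
  rw [← cancel_mono f, Linear.smul_comp, Category.id_comp, zero_comp, hY.comp_smul f hi]

/-- The morphism `ι : E ⟶ X` exhibits `E` as the annihilator `Hom_R(R/I, X)` of the ideal `I` in
`X`. -/
structure IsAnnihilator (I : Ideal R) {E X : C} (ι : E ⟶ X) : Prop where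
  mono : Mono ι
  torsion : IsTorsionObject I E
  exists_lift : ∀ (T : C) (x : T ⟶ X), (∀ i ∈ I, i • x = 0) → ∃ y : T ⟶ E, y ≫ ι = x

lemma exists_isAnnihilator {I : Ideal R} (hI : I.FG) (X : C) :
    ∃ (E : C) (ι : E ⟶ X), IsAnnihilator I ι := by
  obtain ⟨E, ι, hι, h, hl⟩ := exists_relative_annihilator hI (𝟙 X)
  refine ⟨E, ι, hι, fun i hi => ?_, fun T x hx => hl T x (by simpa using hx)⟩
  rw [← cancel_mono ι, Linear.smul_comp, Category.id_comp, zero_comp]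
  simpa using h i hi

/-- An `I`-torsion object that is injective in the full subcategory of `I`-torsion objects. -/
structure IsInjectiveTorsion (I : Ideal R) (E : C) : Prop where
  torsion : IsTorsionObject I E
  exists_extension : ∀ ⦃A B : C⦄ (f : A ⟶ B), Mono f → IsTorsionObject I A → IsTorsionObject I B →
    ∀ g : A ⟶ E, ∃ h : B ⟶ E, f ≫ h = g

/-- The linear map `g : I → C(T, X)`, viewed as a morphism from `T` to `Hom_R(I, X)`, factors
through the canonical map `X ⟶ Hom_R(I, X)` locally, that is after passing to an epimorphism onto
`T`. -/
def IsLocallyMultiplication {I : Ideal R} {T X : C} (g : I →ₗ[R] (T ⟶ X)) : Prop :=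
  ∃ (T' : C) (p : T' ⟶ T) (y : T' ⟶ X), Epi p ∧ ∀ i : I, (i : R) • y = p ≫ g i

/-- Postcomposition of a linear family of morphisms with a morphism. -/
def postcompFamily {M : Type*} [AddCommGroup M] [Module R M] {T X Y : C} (g : M →ₗ[R] (T ⟶ X))
    (f : X ⟶ Y) : M →ₗ[R] (T ⟶ Y) :=
  Linear.rightComp R T f ∘ₗ g

@[simp]
lemma postcompFamily_apply {M : Type*} [AddCommGroup M] [Module R M] {T X Y : C}
    (g : M →ₗ[R] (T ⟶ X)) (f : X ⟶ Y) (m : M) : postcompFamily g f m = g m ≫ f := rfl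

/-- A linear family of morphisms that factor through a monomorphism factors linearly. -/
lemma exists_linear_factor {M : Type*} [AddCommGroup M] [Module R M] {T X Y : C} (j : X ⟶ Y)
    [Mono j] (g : M →ₗ[R] (T ⟶ Y)) (hg : ∀ m, ∃ y : T ⟶ X, y ≫ j = g m) :
    ∃ g' : M →ₗ[R] (T ⟶ X), ∀ m, g' m ≫ j = g m := by
  choose y hy using hg
  refine ⟨{ toFun := y, map_add' := fun a b => ?_, map_smul' := fun r a => ?_ }, hy⟩
  · rw [← cancel_mono j, Preadditive.add_comp, hy, hy, hy, map_add]
  · rw [← cancel_mono j, RingHom.id_apply, Linear.smul_comp, hy, hy, map_smul]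

/-- Multiplication by the elements of `I` on a morphism `x`. -/
def smulFamily (I : Ideal R) {T X : C} (x : T ⟶ X) : I →ₗ[R] (T ⟶ X) :=
  (LinearMap.toSpanSingleton R (T ⟶ X) x) ∘ₗ I.subtype

@[simp]
lemma smulFamily_apply (I : Ideal R) {T X : C} (x : T ⟶ X) (i : I) :
    smulFamily I x i = (i : R) • x := rfl

end LinearAbelian

/-! ### A criterion for injectivity -/

section Criterion

variable {R : Type w} [CommRing R] {C : Type u} [Category.{v} C] [Abelian C] [Linear R C]

/-- The element chase of the injectivity criterion for monomorphisms `f : A ⟶ B` whose cokernel is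
`I`-torsion. In the pushout `Z` of `g` and `f`, the image of an element of `B` differs, locally, from
an element of `X` by an element of the annihilator of `I` in `Z`, and this annihilator retracts
onto `E`. -/
lemma exists_extension_of_torsion_cokernel {I : Ideal R} (hI : I.FG) {E X : C} {ι : E ⟶ X}
    (hι : IsAnnihilator I ι) (hE : IsInjectiveTorsion I E)
    (hX : ∀ (T : C) (g : I →ₗ[R] (T ⟶ X)), IsLocallyMultiplication g)
    {A B : C} (f : A ⟶ B) [Mono f] (hf : ∀ i ∈ I, ∃ b : B ⟶ A, b ≫ f = i • 𝟙 B) (g : A ⟶ X) :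
    ∃ h : B ⟶ X, f ≫ h = g := by
  have := hι.mono
  obtain ⟨b, hb⟩ := exists_linear_factor f (smulFamily I (𝟙 B)) (fun i => hf i i.2)
  obtain ⟨T, p, y, hp, hy⟩ := hX B (postcompFamily b g)
  obtain ⟨Z₀, ζ, hζ⟩ := exists_isAnnihilator hI (pushout f g)
  have := hζ.mono
  let k : B ⟶ pushout f g := pushout.inl f g
  let j : X ⟶ pushout f g := pushout.inr f g
  have hkj : f ≫ k = g ≫ j := pushout.condition
  obtain ⟨z, hz⟩ : ∃ z : T ⟶ Z₀, z ≫ ζ = p ≫ k - y ≫ j := by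
    refine hζ.exists_lift _ _ fun i hi => ?_
    have h₁ := hb ⟨i, hi⟩
    have h₂ := hy ⟨i, hi⟩
    simp only [smulFamily_apply, postcompFamily_apply] at h₁ h₂
    rw [smul_sub, ← Linear.smul_comp _ _ _ i y, h₂]
    simp only [Category.assoc]
    rw [← hkj, ← Category.assoc (b _) f k, h₁]
    simp
  obtain ⟨e, he⟩ : ∃ e : E ⟶ Z₀, e ≫ ζ = ι ≫ j :=
    hζ.exists_lift _ _ fun i hi => hι.torsion.smul_comp _ hi
  have : Mono (e ≫ ζ) := by rw [he]; infer_instance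
  obtain ⟨ρ, hρ⟩ := hE.exists_extension e (mono_of_mono e ζ) hι.torsion hζ.torsion (𝟙 E)
  -- `X ⊞ Z₀` covers the pushout, so a retraction of `j` may be defined on it.
  let q : X ⊞ Z₀ ⟶ pushout f g := biprod.desc j ζ
  have hq : Epi q := by
    rw [Preadditive.epi_iff_cancel_zero]
    intro W t ht
    have hj : j ≫ t = 0 := by simpa [q] using biprod.inl ≫= ht
    have hζt : ζ ≫ t = 0 := by simpa [q] using biprod.inr ≫= ht
    refine pushout.hom_ext ?_ (by simpa using hj)
    have : p ≫ k ≫ t = 0 := by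
      have h := hz =≫ t
      rw [Preadditive.sub_comp, Category.assoc, Category.assoc, Category.assoc, hj, hζt] at h
      simpa using h.symm
    rw [comp_zero]
    exact (cancel_epi p).1 (by simpa using this)
  have hker : kernel.ι q ≫ biprod.desc (𝟙 X) (ρ ≫ ι) = 0 := by
    let u : kernel q ⟶ X := kernel.ι q ≫ biprod.fst
    let v : kernel q ⟶ Z₀ := kernel.ι q ≫ biprod.snd
    have huv : u ≫ j + v ≫ ζ = 0 := by
      have := kernel.condition q
      simpa [q, biprod.desc_eq, u, v] using this
    have hu : u ≫ j = -(v ≫ ζ) := eq_neg_of_add_eq_zero_left huv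
    obtain ⟨t, ht⟩ := hι.exists_lift _ u fun i hi => by
      rw [← cancel_mono j, Linear.smul_comp, zero_comp, hu, ← Preadditive.neg_comp,
        ← Linear.smul_comp, hζ.torsion.comp_smul _ hi, zero_comp]
    have hv : v = -(t ≫ e) := by
      rw [← cancel_mono ζ, Preadditive.neg_comp, Category.assoc t, he, ← Category.assoc t, ht,
        hu, neg_neg]
    have : u + v ≫ ρ ≫ ι = 0 := by
      rw [hv, Preadditive.neg_comp, Category.assoc, ← Category.assoc e ρ, hρ, Category.id_comp, ht,
        add_neg_cancel]
    simpa [biprod.desc_eq, u, v] using this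
  let r : pushout f g ⟶ X := Abelian.epiDesc q _ hker
  have hr : j ≫ r = 𝟙 X := by
    have h : biprod.inl ≫ q ≫ r = 𝟙 X := by simp [r]
    simpa [q] using h
  exact ⟨k ≫ r, by rw [← Category.assoc, hkj, Category.assoc, hr, Category.comp_id]⟩

/-- If the annihilator of the nilpotent ideal `I` in `X` is injective among `I`-torsion objects and
if `X ⟶ Hom_R(I, X)` is an epimorphism, then `X` is injective. -/
lemma injective_of_isAnnihilator {I : Ideal R} (hI : I.FG) (hnil : IsNilpotent I) {E X : C}
    {ι : E ⟶ X} (hι : IsAnnihilator I ι) (hE : IsInjectiveTorsion I E)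
    (hX : ∀ (T : C) (g : I →ₗ[R] (T ⟶ X)), IsLocallyMultiplication g) : Injective X := by
  -- Extend along `f : A ⟶ B` by induction on the power of `I` that annihilates `B / A`.
  have key : ∀ (n : ℕ) {A B : C} (f : A ⟶ B) [Mono f]
      (_ : ∀ i ∈ I ^ n, ∃ b : B ⟶ A, b ≫ f = i • 𝟙 B) (g : A ⟶ X), ∃ h : B ⟶ X, f ≫ h = g := by
    intro n
    induction n with
    | zero =>
      intro A B f _ hf g
      obtain ⟨b, hb⟩ := hf 1 (by simp)
      rw [one_smul] at hb
      have : f ≫ b = 𝟙 A := by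
        rw [← cancel_mono f, Category.assoc, hb, Category.comp_id, Category.id_comp]
      exact ⟨b ≫ g, by rw [← Category.assoc, this, Category.id_comp]⟩
    | succ n ih =>
      intro A B f _ hf g
      obtain ⟨B', κ, hκ, hκI, hκl⟩ := exists_relative_annihilator hI (cokernel.π f)
      obtain ⟨f', hf'⟩ := hκl A f (fun i _ => by simp)
      have : Mono (f' ≫ κ) := by rw [hf']; infer_instance
      have := mono_of_mono f' κ
      obtain ⟨g', hg'⟩ := exists_extension_of_torsion_cokernel hI hι hE hX f' (fun i hi => by
        refine ⟨Abelian.monoLift f (i • κ) (by simpa using hκI i hi), ?_⟩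
        rw [← cancel_mono κ, Category.assoc, hf', Abelian.monoLift_comp, Linear.smul_comp,
          Category.id_comp]) g
      obtain ⟨h, hh⟩ := ih κ (fun r hr => by
        refine hκl B (r • 𝟙 B) fun i hi => ?_
        obtain ⟨b, hb⟩ := hf (i * r) (by
          rw [pow_succ, mul_comm i r]; exact Ideal.mul_mem_mul hr hi)
        rw [← Linear.smul_comp, smul_smul, ← hb, Category.assoc, cokernel.condition, comp_zero]) g'
      exact ⟨h, by rw [← hf', Category.assoc, hh, hg']⟩
  obtain ⟨n, hn⟩ := hnil
  refine ⟨fun g f _ => ?_⟩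
  exact key n f (fun i hi => ⟨0, by
    rw [hn] at hi
    rw [(Submodule.mem_bot R).1 hi, zero_smul, zero_comp]⟩) g

end Criterion

/-! ### Flatness solves multiplication problems -/

section Flat

/-- Flatness for the module `R / I`: the class in `Ext¹_R(R / I, C(A, E))` of a linear map
`g : I → C(A, E)` is effaced by an epimorphism `p` onto `A` and a monomorphism `j` out of `E`, which
means that `i ↦ p ≫ g i ≫ j` extends to `R`. -/
lemma IsFlat.exists_multiplication {R : Type v} [CommRing R] {C : Type u} [Category.{v} C]
    [Abelian C] [Linear R C] (hC : IsFlat R C) (I : Ideal R)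
    (hI : Module.FinitePresentation R (R ⧸ I)) {A E : C} (g : I →ₗ[R] (A ⟶ E)) :
    ∃ (Y B : C) (p : Y ⟶ A) (j : E ⟶ B) (f : Y ⟶ B), Epi p ∧ Mono j ∧
      ∀ i : I, (i : R) • f = p ≫ g i ≫ j := by
  let S : ShortComplex (ModuleCat.{v} R) := ShortComplex.mk
    (ModuleCat.ofHom I.subtype) (ModuleCat.ofHom I.mkQ)
    (by ext; simp [Ideal.Quotient.eq_zero_iff_mem])
  have hS : S.ShortExact :=
    { exact := by
        rw [ShortComplex.ShortExact.moduleCat_exact_iff_function_exact]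
        exact LinearMap.exact_subtype_mkQ I
      mono_f := (ModuleCat.mono_iff_injective _).2 I.injective_subtype
      epi_g := (ModuleCat.epi_iff_surjective _).2 I.mkQ_surjective }
  let N : ModuleCat.{v} R := (Functor.uncurry.obj (linearCoyoneda R C)).obj (Opposite.op A, E)
  let G : S.X₁ ⟶ N := ModuleCat.ofHom g
  let x : Abelian.Ext S.X₃ N 1 := hS.extClass.comp (Abelian.Ext.mk₀ G) (add_zero 1)
  obtain ⟨⟨Y, B⟩, ⟨p, j⟩, hpj, hx⟩ := hC (ModuleCat.of R (R ⧸ I)) hI (Opposite.op A, E) x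
  change Mono (p ×ₘ j) at hpj
  have hp : Epi p.unop := ⟨fun {W} a b hab => by
    have h : (a.op ×ₘ 𝟙 E) ≫ (p ×ₘ j) = (b.op ×ₘ 𝟙 E) ≫ (p ×ₘ j) :=
      Prod.ext (Quiver.Hom.unop_inj hab) rfl
    exact Quiver.Hom.op_inj (congrArg Prod.fst ((cancel_mono _).1 h))⟩
  have hj : Mono j := ⟨fun {W} a b hab => by
    have h : (𝟙 (Opposite.op A) ×ₘ a) ≫ (p ×ₘ j) =
        (𝟙 (Opposite.op A) ×ₘ b) ≫ (p ×ₘ j) := Prod.ext rfl hab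
    exact congrArg Prod.snd ((cancel_mono _).1 h)⟩
  let N' : ModuleCat.{v} R := (Functor.uncurry.obj (linearCoyoneda R C)).obj (Y, B)
  let P : N ⟶ N' := (Functor.uncurry.obj (linearCoyoneda R C)).map (p ×ₘ j)
  have hx' : hS.extClass.comp (Abelian.Ext.mk₀ (G ≫ P)) (add_zero 1) = 0 := by
    rw [← Abelian.Ext.mk₀_comp_mk₀, ← Abelian.Ext.comp_assoc_of_second_deg_zero]
    exact hx
  obtain ⟨e, he⟩ := Abelian.Ext.contravariant_sequence_exact₁ hS N' _ _ hx'
  obtain ⟨e, rfl⟩ := (Abelian.Ext.mk₀_bijective _ _).2 e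
  rw [Abelian.Ext.mk₀_comp_mk₀] at he
  have he' := (Abelian.Ext.mk₀_bijective _ _).1 he
  let e' : R →ₗ[R] (Y.unop ⟶ B) := e.hom
  refine ⟨Y.unop, B, p.unop, j, e' 1, hp, hj, fun i => ?_⟩
  rw [← map_smul, smul_eq_mul, mul_one]
  have := LinearMap.congr_fun (congrArg ModuleCat.Hom.hom he') i
  refine this.trans ?_
  exact Category.assoc _ _ _

end Flat

/-! ### Lifting injectives -/

section Lifting

/-- Under flatness, an object `X` with injective annihilator `E` embeds into an object `X'` with the
same annihilator such that every linear map `I → C(T, X)` is locally multiplication on an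
element of `X'`. By flatness the canonical map `I → C(Hom_R(I, X), X)` becomes multiplication on an
element of some `B ⊇ X`. The subobject `B'` of `B` where `I` maps into `X` may have an annihilator
`N` larger than `E`; as `E` is injective it has a complement `N'` in `N`, and `X' = B' / N'`. -/
lemma IsFlat.exists_enlargement {R : Type v} [CommRing R] {C : Type u} [Category.{v} C]
    [Abelian C] [Linear R C] (hC : IsFlat R C) {I : Ideal R} (hI : I.FG)
    (hRI : Module.FinitePresentation R (R ⧸ I)) (hIfp : Module.FinitePresentation R I)
    {E X : C} {ι : E ⟶ X} (hι : IsAnnihilator I ι) (hE : IsInjectiveTorsion I E) :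
    ∃ (X' : C) (j : X ⟶ X'), Mono j ∧ IsAnnihilator I (ι ≫ j) ∧
      ∀ (T : C) (g : I →ₗ[R] (T ⟶ X)), IsLocallyMultiplication (postcompFamily g j) := by
  have := hι.mono
  obtain ⟨H, h, hH⟩ := exists_homObject (R := R) I X
  obtain ⟨Y, B, p, j, f, hp, hj, hf⟩ := hC.exists_multiplication I hRI h
  obtain ⟨B', κ, hκ, hκI, hκl⟩ := exists_relative_annihilator hI (cokernel.π j)
  obtain ⟨j', hj'⟩ := hκl X j (fun i _ => by simp)
  obtain ⟨f', hf'⟩ := hκl Y f (fun i hi => by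
    rw [← Linear.smul_comp, hf ⟨i, hi⟩]; simp)
  have : Mono (j' ≫ κ) := by rw [hj']; infer_instance
  have hj'm : Mono j' := mono_of_mono j' κ
  -- `I` maps `B'` into `X`
  have hIB : ∀ {T : C} (x : T ⟶ B') (i : R), i ∈ I → ∃ y : T ⟶ X, y ≫ j' = i • x := by
    intro T x i hi
    refine ⟨Abelian.monoLift j (i • x ≫ κ) ?_, ?_⟩
    · rw [Linear.smul_comp, Category.assoc, ← Linear.comp_smul, hκI i hi, comp_zero]
    · rw [← cancel_mono κ, Category.assoc, hj', Abelian.monoLift_comp, Linear.smul_comp]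
  obtain ⟨N, ν, hν⟩ := exists_isAnnihilator hI B'
  have := hν.mono
  obtain ⟨e, he⟩ := hν.exists_lift E (ι ≫ j') fun i hi => hι.torsion.smul_comp _ hi
  have : Mono (e ≫ ν) := by rw [he]; infer_instance
  obtain ⟨ρ, hρ⟩ := hE.exists_extension e (mono_of_mono e ν) hι.torsion hν.torsion (𝟙 E)
  let n : kernel ρ ⟶ B' := kernel.ι ρ ≫ ν
  let q : B' ⟶ cokernel n := cokernel.π n
  have hnq : kernel.ι ρ ≫ ν ≫ q = 0 := by
    have := cokernel.condition n
    rwa [Category.assoc] at this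
  -- the kernel of `q` consists of the elements of `N` annihilated by `ρ`
  have hq : ∀ {T : C} (x : T ⟶ B'), x ≫ q = 0 → ∃ y : T ⟶ N, y ≫ ν = x ∧ y ≫ ρ = 0 := by
    intro T x hx
    exact ⟨Abelian.monoLift n x hx ≫ kernel.ι ρ, by
      rw [Category.assoc]; exact Abelian.monoLift_comp n x hx, by simp⟩
  have hjq : ∀ {T : C} (x : T ⟶ X), x ≫ j' ≫ q = 0 → x = 0 := by
    intro T x hx
    obtain ⟨y, hy, hyρ⟩ := hq (x ≫ j') (by simpa using hx)
    obtain ⟨t, rfl⟩ := hι.exists_lift T x fun i hi => by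
      rw [← cancel_mono j', Linear.smul_comp, ← hy, ← Linear.smul_comp,
        hν.torsion.comp_smul _ hi, zero_comp, zero_comp]
    have hyt : y = t ≫ e := by
      rw [← cancel_mono ν, hy, Category.assoc, Category.assoc, he]
    rw [hyt, Category.assoc, hρ, Category.comp_id] at hyρ
    rw [hyρ, zero_comp]
  have hmono : Mono (j' ≫ q) :=
    Preadditive.mono_of_cancel_zero _ fun x hx => hjq x hx
  refine ⟨cokernel n, j' ≫ q, hmono, ⟨mono_comp _ _, hι.torsion, fun T x hx => ?_⟩,
    fun T g => ?_⟩
  · obtain ⟨T', π, hπ, b, hb⟩ := surjective_up_to_refinements_of_epi q x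
    have hbI : ∀ i ∈ I, i • b = 0 := by
      intro i hi
      obtain ⟨c, hc⟩ := hIB b i hi
      have : c = 0 := hjq c (by
        rw [← Category.assoc, hc, Linear.smul_comp, ← hb, ← Linear.comp_smul, hx i hi, comp_zero])
      rw [← hc, this, zero_comp]
    obtain ⟨m, hm⟩ := hν.exists_lift T' b hbI
    refine exists_factor_of_epi_comp (p := π) (y := m ≫ ρ) ?_
    have hk : (m - m ≫ ρ ≫ e) ≫ ρ = 0 := by
      rw [Preadditive.sub_comp, Category.assoc, Category.assoc, hρ, Category.comp_id, sub_self]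
    have hz : (m - m ≫ ρ ≫ e) ≫ ν ≫ q = 0 := by
      rw [← kernel.lift_ι ρ _ hk, Category.assoc, hnq, comp_zero]
    rw [Preadditive.sub_comp, sub_eq_zero] at hz
    rw [hb, ← hm, Category.assoc, Category.assoc, hz, Category.assoc, Category.assoc,
      ← Category.assoc e, he, Category.assoc]
  · obtain ⟨t, ht⟩ := hH T g
    obtain ⟨T', π, hπ, t', ht'⟩ := surjective_up_to_refinements_of_epi p t
    refine ⟨T', π, t' ≫ f' ≫ q, hπ, fun i => ?_⟩
    have key : (i : R) • f' = p ≫ h i ≫ j' := by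
      rw [← cancel_mono κ, Linear.smul_comp, hf', hf i, Category.assoc, Category.assoc, hj']
    rw [← Linear.comp_smul, ← Linear.smul_comp, key, postcompFamily_apply, ← ht]
    simp only [Category.assoc]
    rw [reassoc_of% ht']

/-- Iterating the enlargement: for every `n` there is an object `X` with annihilator `E` such that
every linear map `I → C(T, X)` with values killed by `Iⁿ` is locally multiplication on an element
of `X`. The elements of the enlargement `X'` killed by `Iⁿ⁺¹` already lie in `X`. -/
lemma IsFlat.exists_approximation {R : Type v} [CommRing R] {C : Type u} [Category.{v} C]
    [Abelian C] [Linear R C] (hC : IsFlat R C) {I : Ideal R} (hI : I.FG)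
    (hRI : Module.FinitePresentation R (R ⧸ I)) (hIfp : Module.FinitePresentation R I)
    {E : C} (hE : IsInjectiveTorsion I E) (n : ℕ) :
    ∃ (X : C) (ι : E ⟶ X), IsAnnihilator I ι ∧ ∀ (T : C) (g : I →ₗ[R] (T ⟶ X)),
      (∀ i, ∀ r ∈ I ^ n, r • g i = 0) → IsLocallyMultiplication g := by
  induction n with
  | zero =>
    refine ⟨E, 𝟙 E, ⟨inferInstance, hE.torsion, fun T x _ => ⟨x, Category.comp_id x⟩⟩,
      fun T g hg => ⟨T, 𝟙 T, 0, inferInstance, fun i => ?_⟩⟩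
    have : g i = 0 := by simpa using hg i 1 (by simp)
    rw [this, smul_zero, comp_zero]
  | succ n ih =>
    obtain ⟨X, ι, hι, hX⟩ := ih
    obtain ⟨X', j, hj, hιj, hX'⟩ := hC.exists_enlargement hI hRI hIfp hι hE
    have lift : ∀ l ≤ n + 1, ∀ (T : C) (x : T ⟶ X'), (∀ r ∈ I ^ l, r • x = 0) →
        ∃ y : T ⟶ X, y ≫ j = x := by
      intro l
      induction l with
      | zero =>
        intro _ T x hx
        exact ⟨0, by rw [zero_comp]; simpa using (hx 1 (by simp)).symm⟩
      | succ l ihl =>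
        intro hl T x hx
        have hIx : ∀ i : I, ∀ r ∈ I ^ l, r • (i : R) • x = 0 := fun i r hr => by
          rw [smul_smul]
          exact hx _ (by rw [pow_succ]; exact Ideal.mul_mem_mul hr i.2)
        obtain ⟨g, hg⟩ := exists_linear_factor j (smulFamily I x) fun i =>
          ihl (by lia) T _ (hIx i)
        obtain ⟨T', p, y, hp, hy⟩ := hX T g fun i r hr => by
          rw [← cancel_mono j, Linear.smul_comp, hg, zero_comp]
          exact hIx i r (Ideal.pow_le_pow_right (by lia) hr)
        obtain ⟨z, hz⟩ := hιj.exists_lift T' (p ≫ x - y ≫ j) fun i hi => by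
          have h₁ := hy ⟨i, hi⟩
          have h₂ := hg ⟨i, hi⟩
          simp only [smulFamily_apply] at h₁ h₂
          rw [smul_sub, ← Linear.smul_comp _ _ _ i y, h₁, Category.assoc, h₂,
            Linear.comp_smul, sub_self]
        refine exists_factor_of_epi_comp (p := p) (y := y + z ≫ ι) ?_
        rw [Preadditive.add_comp, Category.assoc, hz, add_sub_cancel]
    refine ⟨X', ι ≫ j, hιj, fun T g hg => ?_⟩
    obtain ⟨g', hg'⟩ := exists_linear_factor j g fun i => lift (n + 1) le_rfl T _ (hg i)
    have : postcompFamily g' j = g := LinearMap.ext hg'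
    exact this ▸ hX' T g'

/-- Every injective object `E` of the category of `I`-torsion objects of a flat abelian category is
the annihilator of `I` in an injective object. -/
lemma IsFlat.exists_injective_lift {R : Type v} [CommRing R] {C : Type u} [Category.{v} C]
    [Abelian C] [Linear R C] (hC : IsFlat R C) {I : Ideal R} (hI : I.FG) (hnil : IsNilpotent I)
    (hRI : Module.FinitePresentation R (R ⧸ I)) (hIfp : Module.FinitePresentation R I)
    {E : C} (hE : IsInjectiveTorsion I E) :
    ∃ (X : C) (ι : E ⟶ X), IsAnnihilator I ι ∧ Injective X := by
  obtain ⟨n, hn⟩ := id hnil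
  obtain ⟨X, ι, hι, hX⟩ := hC.exists_approximation hI hRI hIfp hE n
  refine ⟨X, ι, hι, injective_of_isAnnihilator hI hnil hι hE fun T g => hX T g ?_⟩
  intro i r hr
  rw [hn] at hr
  rw [(Submodule.mem_bot R).1 hr, zero_smul]

/-- A morphism out of `X` is a monomorphism if it is one on the annihilator of the nilpotent ideal
`I` in `X`. -/
lemma mono_of_isAnnihilator {R : Type w} [CommRing R] {C : Type u} [Category.{v} C] [Abelian C]
    [Linear R C] {I : Ideal R} (hnil : IsNilpotent I) {E X Y : C} {ι : E ⟶ X}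
    (hι : IsAnnihilator I ι) (f : X ⟶ Y) (hf : Mono (ι ≫ f)) : Mono f := by
  have key : ∀ (n : ℕ) {T : C} (x : T ⟶ X), x ≫ f = 0 → (∀ r ∈ I ^ n, r • x = 0) → x = 0 := by
    intro n
    induction n with
    | zero =>
      intro T x _ hx
      simpa using hx 1 (by simp)
    | succ n ih =>
      intro T x hxf hx
      obtain ⟨y, rfl⟩ := hι.exists_lift T x fun i hi => by
        refine ih (i • x) (by rw [Linear.smul_comp, hxf, smul_zero]) fun r hr => ?_
        rw [smul_smul]
        exact hx _ (by rw [pow_succ]; exact Ideal.mul_mem_mul hr hi)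
      have hy : y = 0 := (cancel_mono (ι ≫ f)).1 (by rwa [zero_comp, ← Category.assoc])
      rw [hy, zero_comp]
  obtain ⟨n, hn⟩ := hnil
  refine Preadditive.mono_of_cancel_zero _ fun x hx => key n x hx fun r hr => ?_
  rw [hn] at hr
  rw [(Submodule.mem_bot R).1 hr, zero_smul]

/-- If the `I`-torsion objects of a flat abelian category have enough injectives, for a nilpotent
ideal `I`, then so does the whole category. -/
lemma IsFlat.enoughInjectives {R : Type v} [CommRing R] {C : Type u} [Category.{v} C]
    [Abelian C] [Linear R C] (hC : IsFlat R C) {I : Ideal R} (hI : I.FG) (hnil : IsNilpotent I)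
    (hRI : Module.FinitePresentation R (R ⧸ I)) (hIfp : Module.FinitePresentation R I)
    (htors : ∀ X : C, IsTorsionObject I X → ∃ (E : C) (f : X ⟶ E), Mono f ∧
      IsInjectiveTorsion I E) : EnoughInjectives C := by
  refine ⟨fun X => ?_⟩
  obtain ⟨X₀, κ, hκ⟩ := exists_isAnnihilator hI X
  obtain ⟨E, f, hf, hE⟩ := htors X₀ hκ.torsion
  obtain ⟨J, ι, hι, hJ⟩ := hC.exists_injective_lift hI hnil hRI hIfp hE
  have := hκ.mono
  have := hι.mono
  have hfac : κ ≫ Injective.factorThru (f ≫ ι) κ = f ≫ ι := Injective.comp_factorThru _ _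
  exact ⟨⟨J, hJ, Injective.factorThru (f ≫ ι) κ,
    mono_of_isAnnihilator hnil hκ _ (by rw [hfac]; infer_instance)⟩⟩

end Lifting

/-! ### Deformations and torsion objects -/

section Deformation

variable {R : Type w} {S : Type u} [CommRing R] [CommRing S] {θ : R →+* S}

lemma IsNilpotentThickening.fg_ker (hθ : IsNilpotentThickening θ) : (RingHom.ker θ).FG := by
  let : Module R S := Module.compHom S θ
  have : Module.FinitePresentation R S := hθ.finitePresentation
  let l : R →ₗ[R] S :=
    { toFun := θ
      map_add' := map_add θ
      map_smul' := map_mul θ }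
  exact Module.FinitePresentation.fg_ker l hθ.surjective

lemma IsNilpotentThickening.finitePresentation_quotient (hθ : IsNilpotentThickening θ) :
    Module.FinitePresentation R (R ⧸ RingHom.ker θ) :=
  Module.finitePresentation_of_surjective (RingHom.ker θ).mkQ (Submodule.mkQ_surjective _)
    (by rw [Submodule.ker_mkQ]; exact hθ.fg_ker)

lemma IsNilpotentThickening.finitePresentation_ker (hθ : IsNilpotentThickening θ) :
    Module.FinitePresentation R (RingHom.ker θ) :=
  hθ.coherent_source.finitePresentation_of_fg _ hθ.fg_ker

section SObject

variable {C : Type u₁} [Category.{v₁} C] [Abelian C] [Linear R C]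

lemma SObject.isTorsionObject (A : SObject θ C) : IsTorsionObject (RingHom.ker θ) A.X := by
  intro r hr
  rw [← A.φ_comp r, (RingHom.mem_ker).1 hr, map_zero]

/-- If `θ` is surjective, the object of `C` underlying an `S`-object determines the action of
`S`, and every morphism of `C` between `S`-objects is compatible with it. -/
def SObject.homMk (hθ : Function.Surjective θ) {A B : SObject θ C} (f : A.X ⟶ B.X) : A ⟶ B :=
  { hom := f
    comm := fun s => by
      obtain ⟨r, rfl⟩ := hθ s
      rw [A.φ_comp, B.φ_comp, Linear.smul_comp, Linear.comp_smul, Category.id_comp,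
        Category.comp_id] }

/-- If `θ` is surjective, an object annihilated by `ker θ` is an `S`-object. -/
def SObject.ofTorsion (hθ : Function.Surjective θ) {X : C}
    (hX : IsTorsionObject (RingHom.ker θ) X) : SObject θ C where
  X := X
  φ := θ.liftOfSurjective hθ ⟨algebraMap R (End X), fun r hr => by
    rw [RingHom.mem_ker, Algebra.algebraMap_eq_smul_one]
    exact hX r hr⟩
  φ_comp r := by
    have := RingHom.liftOfRightInverse_comp_apply θ _ (Function.rightInverse_surjInv hθ)
      ⟨algebraMap R (End X), fun r hr => by
        rw [RingHom.mem_ker, Algebra.algebraMap_eq_smul_one]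
        exact hX r hr⟩ r
    refine this.trans ?_
    rw [Algebra.algebraMap_eq_smul_one]
    rfl

lemma SObject.mono_hom (hθ : Function.Surjective θ) {A B : SObject θ C} (f : A ⟶ B) [Mono f] :
    Mono (SObject.Hom.hom f) := by
  let K : SObject θ C := SObject.ofTorsion hθ (A.isTorsionObject.of_mono (kernel.ι f.hom))
  let k : K ⟶ A := SObject.homMk hθ (kernel.ι f.hom)
  have h : k = SObject.homMk hθ 0 := by
    rw [← cancel_mono f]
    refine SObject.Hom.ext ?_
    change kernel.ι f.hom ≫ f.hom = 0 ≫ f.hom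
    rw [kernel.condition, zero_comp]
  exact Preadditive.mono_of_kernel_zero (congrArg SObject.Hom.hom h)

end SObject

variable {C : Type u₁} [Category.{v₁} C] [Abelian C] [Linear R C]
  {D : Type u₂} [Category.{v₂} D] [Abelian D] [Linear S D] {F : D ⥤ C}

lemma IsDeformation.faithful (hF : IsDeformation θ F) : F.Faithful := by
  have := hF.isEquivalence
  exact ⟨fun {_ _ f g} h =>
    (SObject.lift F hF.additive hF.map_smul).map_injective (SObject.Hom.ext h)⟩

lemma IsDeformation.full (hF : IsDeformation θ F) (hθ : Function.Surjective θ) : F.Full := by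
  have := hF.isEquivalence
  refine ⟨fun {Y Z} f => ?_⟩
  obtain ⟨g, hg⟩ := (SObject.lift F hF.additive hF.map_smul).map_surjective
    (SObject.homMk hθ f : (SObject.lift F hF.additive hF.map_smul).obj Y ⟶
      (SObject.lift F hF.additive hF.map_smul).obj Z)
  exact ⟨g, congrArg SObject.Hom.hom hg⟩

lemma IsDeformation.isTorsionObject (hF : IsDeformation θ F) (Y : D) :
    IsTorsionObject (RingHom.ker θ) (F.obj Y) :=
  ((SObject.lift F hF.additive hF.map_smul).obj Y).isTorsionObject

lemma IsDeformation.exists_iso (hF : IsDeformation θ F) (hθ : Function.Surjective θ) {X : C}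
    (hX : IsTorsionObject (RingHom.ker θ) X) : ∃ Y : D, Nonempty (F.obj Y ≅ X) := by
  have := hF.isEquivalence
  let G := SObject.lift F hF.additive hF.map_smul
  let A : SObject θ C := SObject.ofTorsion hθ hX
  let e : G.obj (G.objPreimage A) ≅ A := G.objObjPreimageIso A
  exact ⟨G.objPreimage A, ⟨⟨e.hom.hom, e.inv.hom, congrArg SObject.Hom.hom e.hom_inv_id,
    congrArg SObject.Hom.hom e.inv_hom_id⟩⟩⟩

lemma IsDeformation.mono_map (hF : IsDeformation θ F) (hθ : Function.Surjective θ) {Y Z : D}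
    (f : Y ⟶ Z) [Mono f] : Mono (F.map f) := by
  have := hF.isEquivalence
  exact SObject.mono_hom hθ ((SObject.lift F hF.additive hF.map_smul).map f)

lemma IsDeformation.isInjectiveTorsion (hF : IsDeformation θ F) (hθ : Function.Surjective θ)
    (J : D) [Injective J] : IsInjectiveTorsion (RingHom.ker θ) (F.obj J) := by
  refine ⟨hF.isTorsionObject J, fun A B f hf hA hB g => ?_⟩
  have := hF.full hθ
  have := hF.faithful
  obtain ⟨A', ⟨a⟩⟩ := hF.exists_iso hθ hA
  obtain ⟨B', ⟨b⟩⟩ := hF.exists_iso hθ hB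
  obtain ⟨f', hf'⟩ := F.map_surjective (a.hom ≫ f ≫ b.inv)
  obtain ⟨g', hg'⟩ := F.map_surjective (a.hom ≫ g)
  have : Mono (F.map f') := by rw [hf']; infer_instance
  have : Mono f' := F.mono_of_mono_map this
  refine ⟨b.inv ≫ F.map (Injective.factorThru g' f'), ?_⟩
  rw [← cancel_epi a.hom, ← hg', ← Injective.comp_factorThru g' f', F.map_comp, hf']
  simp

lemma IsDeformation.exists_mono_isInjectiveTorsion (hF : IsDeformation θ F)
    (hθ : Function.Surjective θ) [EnoughInjectives D] {X : C}
    (hX : IsTorsionObject (RingHom.ker θ) X) :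
    ∃ (E : C) (f : X ⟶ E), Mono f ∧ IsInjectiveTorsion (RingHom.ker θ) E := by
  obtain ⟨Y, ⟨e⟩⟩ := hF.exists_iso hθ hX
  have := hF.mono_map hθ (Injective.ι Y)
  exact ⟨F.obj (Injective.under Y), e.inv ≫ F.map (Injective.ι Y), mono_comp _ _,
    hF.isInjectiveTorsion hθ _⟩

end Deformation

/-- A flat nilpotent deformation of an abelian category with enough injectives has enough
injectives. -/
lemma IsDeformation.enoughInjectives {R : Type v} {S : Type w} [CommRing R] [CommRing S]
    {θ : R →+* S} (hθ : IsNilpotentThickening θ) {C : Type u₁} [Category.{v} C] [Abelian C]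
    [Linear R C] {D : Type u₂} [Category.{v₂} D] [Abelian D] [Linear S D] {F : D ⥤ C}
    (hF : IsDeformation θ F) (hC : IsFlat R C) [EnoughInjectives D] : EnoughInjectives C :=
  hC.enoughInjectives hθ.fg_ker hθ.isNilpotent_ker hθ.finitePresentation_quotient
    hθ.finitePresentation_ker fun _ hX => hF.exists_mono_isInjectiveTorsion hθ.surjective hX

/-! ### A deformation of vector spaces without enough injectives -/

section Counterexample

section FiniteMultiplication

variable {R : Type v} [CommRing R]

/-- The modules on which multiplication by `r` has finitely generated image. -/
def finiteMultiplication (r : R) : ObjectProperty (ModuleCat.{v} R) := fun X =>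
  Module.Finite R (LinearMap.range (LinearMap.lsmul R X r))

/-- A linear map restricts to the images of multiplication by `r`. -/
def rangeLsmulMap (r : R) {X Y : Type*} [AddCommGroup X] [Module R X] [AddCommGroup Y] [Module R Y]
    (f : X →ₗ[R] Y) :
    LinearMap.range (LinearMap.lsmul R X r) →ₗ[R] LinearMap.range (LinearMap.lsmul R Y r) :=
  f.restrict fun x hx => by
    obtain ⟨y, rfl⟩ := hx
    exact ⟨f y, (f.map_smul r y).symm⟩

instance (r : R) [IsNoetherianRing R] : (finiteMultiplication r).IsClosedUnderSubobjects where
  prop_of_mono {X Y} f hf hY := by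
    have : Module.Finite R (LinearMap.range (LinearMap.lsmul R Y r)) := hY
    refine Module.Finite.of_injective (rangeLsmulMap r f.hom) fun x y hxy => ?_
    exact Subtype.ext ((ModuleCat.mono_iff_injective f).1 hf (congrArg Subtype.val hxy))

instance (r : R) : (finiteMultiplication r).IsClosedUnderQuotients where
  prop_of_epi {X Y} f hf hX := by
    have : Module.Finite R (LinearMap.range (LinearMap.lsmul R X r)) := hX
    refine Module.Finite.of_surjective (rangeLsmulMap r f.hom) ?_
    rintro ⟨_, y, rfl⟩
    obtain ⟨x, rfl⟩ := (ModuleCat.epi_iff_surjective f).1 hf y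
    exact ⟨⟨r • x, x, rfl⟩, Subtype.ext (f.hom.map_smul r x)⟩

instance (r : R) : (finiteMultiplication r).ContainsZero where
  exists_zero := ⟨ModuleCat.of R PUnit, ModuleCat.isZero_of_subsingleton _, by
    change Module.Finite R (LinearMap.range (LinearMap.lsmul R PUnit.{v + 1} r))
    infer_instance⟩

instance (r : R) [IsNoetherianRing R] : (finiteMultiplication r).IsClosedUnderFiniteProducts where
  isClosedUnderLimitsOfShape J _ := ⟨by
    rintro X ⟨p⟩
    have (j : J) : Module.Finite R (LinearMap.range (LinearMap.lsmul R (p.diag.obj ⟨j⟩) r)) :=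
      p.prop_diag_obj ⟨j⟩
    refine Module.Finite.of_injective
      (LinearMap.pi fun j : J => rangeLsmulMap r (p.π.app ⟨j⟩).hom) fun x y hxy => ?_
    refine Subtype.ext (Concrete.isLimit_ext _ p.isLimit _ _ fun ⟨j⟩ => ?_)
    exact congrArg Subtype.val (congrFun hxy j)⟩

end FiniteMultiplication

variable (k : Type v) [Field k]

/-- The augmentation `k[ε] → k`. -/
abbrev dualNumberFst : DualNumber k →+* k := (TrivSqZeroExt.fstHom k k k : DualNumber k →+* k)

lemma dualNumberFst_surjective : Function.Surjective (dualNumberFst k) :=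
  fun c => ⟨TrivSqZeroExt.inl c, TrivSqZeroExt.fst_inl k c⟩

instance : Module.Finite k (DualNumber k) :=
  inferInstanceAs (Module.Finite k (k × k))

instance : IsNoetherianRing (DualNumber k) :=
  IsNoetherianRing.of_finite k (DualNumber k)

lemma isCoherentRing_of_isNoetherianRing (R : Type u) [CommRing R] [IsNoetherianRing R] :
    IsCoherentRing R :=
  ⟨fun I _ => Module.finitePresentation_of_finite R I⟩

lemma isNilpotentThickening_dualNumberFst : IsNilpotentThickening (dualNumberFst k) where
  coherent_source := isCoherentRing_of_isNoetherianRing _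
  coherent_target := isCoherentRing_of_isNoetherianRing _
  finitePresentation := by
    let : Module (DualNumber k) k := Module.compHom k (dualNumberFst k)
    let l : DualNumber k →ₗ[DualNumber k] k :=
      { toFun := dualNumberFst k
        map_add' := map_add _
        map_smul' := map_mul (dualNumberFst k) }
    have : Module.Finite (DualNumber k) k :=
      Module.Finite.of_surjective l (dualNumberFst_surjective k)
    exact Module.finitePresentation_of_finite _ _
  surjective := dualNumberFst_surjective k
  isNilpotent_ker := by
    refine ⟨2, ?_⟩
    rw [pow_two, Ideal.zero_eq_bot, eq_bot_iff, Ideal.mul_le]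
    intro a ha b hb
    have ha' : TrivSqZeroExt.fst a = 0 := ha
    have hb' : TrivSqZeroExt.fst b = 0 := hb
    rw [Ideal.mem_bot]
    ext <;> simp [ha', hb']

/-- The `k[ε]`-modules `X` for which `ε X` is finite-dimensional. -/
abbrev FiniteEps : Type (v + 1) :=
  (finiteMultiplication (DualNumber.eps : DualNumber k)).FullSubcategory

/-- The inclusion of the vector spaces, on which `ε` acts by zero. -/
def vectorSpaces : ModuleCat.{v} k ⥤ FiniteEps k :=
  (finiteMultiplication (DualNumber.eps : DualNumber k)).lift
    (ModuleCat.restrictScalars (dualNumberFst k)) fun V => by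
      have : LinearMap.range (LinearMap.lsmul (DualNumber k)
          ((ModuleCat.restrictScalars (dualNumberFst k)).obj V) DualNumber.eps) = ⊥ := by
        rw [LinearMap.range_eq_bot]
        ext x
        exact (congrArg (fun c : k => c • (x : V)) (TrivSqZeroExt.fst_inr k (1 : k))).trans
          (zero_smul k _)
      change Module.Finite _ _
      rw [this]
      infer_instance

lemma inr_fst_mul (r : DualNumber k) (c : k) :
    (TrivSqZeroExt.inr (TrivSqZeroExt.fst r * c) : DualNumber k) = r * TrivSqZeroExt.inr c := by
  ext <;> simp [mul_comm]

variable {k} in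
/-- A `k[ε]`-linear map between vector spaces, on which `ε` acts by zero, is `k`-linear. -/
def vectorSpacesPreimage {V W : ModuleCat.{v} k}
    (f : (vectorSpaces k).obj V ⟶ (vectorSpaces k).obj W) : V ⟶ W :=
  ModuleCat.ofHom (X := V) (Y := W)
    { toFun := f.hom.hom
      map_add' := f.hom.hom.map_add
      map_smul' := fun c x => f.hom.hom.map_smul (TrivSqZeroExt.inl c : DualNumber k) x }

lemma isDeformation_vectorSpaces : IsDeformation (dualNumberFst k) (vectorSpaces k) where
  additive := ⟨rfl⟩
  map_smul _ _ _ _ := rfl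
  isEquivalence :=
    { faithful := ⟨fun {V W f g} h => by
        refine ModuleCat.hom_ext (LinearMap.ext fun x => ?_)
        have h₁ : (vectorSpaces k).map f = (vectorSpaces k).map g := congrArg SObject.Hom.hom h
        have h₂ := congrArg
          (fun t : (vectorSpaces k).obj V ⟶ (vectorSpaces k).obj W => t.hom.hom x) h₁
        exact h₂⟩
      full := ⟨fun f => ⟨vectorSpacesPreimage f.hom, rfl⟩⟩
      essSurj := ⟨fun A => by
        have hA : ∀ (r : DualNumber k) (x : A.X.obj), TrivSqZeroExt.fst r = 0 → r • x = 0 := by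
          intro r x hr
          have h := A.isTorsionObject r hr
          exact congrArg (fun t : A.X ⟶ A.X => t.hom.hom x) h
        let V : ModuleCat.{v} k :=
          (ModuleCat.restrictScalars (TrivSqZeroExt.inlHom k k)).obj A.X.obj
        have hsmul : ∀ (r : DualNumber k) (x : A.X.obj),
            r • x = (TrivSqZeroExt.inl (TrivSqZeroExt.fst r) : DualNumber k) • x := by
          intro r x
          rw [← sub_eq_zero, ← sub_smul]
          exact hA _ x (by simp)
        let e : ((vectorSpaces k).obj V).obj ≃ₗ[DualNumber k] A.X.obj :=
          { toFun := fun x => x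
            invFun := fun x => x
            map_add' := fun _ _ => rfl
            map_smul' := fun r x => (hsmul r x).symm }
        let i : (vectorSpaces k).obj V ≅ A.X := ObjectProperty.isoMk _ e.toModuleIso
        exact ⟨V, ⟨⟨SObject.homMk (dualNumberFst_surjective k) i.hom,
          SObject.homMk (dualNumberFst_surjective k) i.inv,
          SObject.Hom.ext i.hom_inv_id, SObject.Hom.ext i.inv_hom_id⟩⟩⟩⟩ }

/-- An injective object `J` containing an infinite-dimensional space `V` would contain `V` in
`ε J`, as every `v : V` extends from `ε k[ε] ≅ k` to `k[ε]`. -/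
lemma not_enoughInjectives_finiteEps : ¬ EnoughInjectives (FiniteEps k) := by
  intro _
  let V : ModuleCat.{v} k := ModuleCat.of k (ℕ →₀ k)
  let J : FiniteEps k := Injective.under ((vectorSpaces k).obj V)
  let ι : (vectorSpaces k).obj V ⟶ J := Injective.ι _
  have := (finiteMultiplication
    (DualNumber.eps : DualNumber k)).preservesMonomorphisms_ι_of_isNormalEpiCategory
  have hι : Function.Injective ι.hom :=
    (ModuleCat.mono_iff_injective _).1
      (inferInstanceAs (Mono ((finiteMultiplication (DualNumber.eps : DualNumber k)).ι.map ι)))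
  let K : FiniteEps k := ⟨ModuleCat.of (DualNumber k) (DualNumber k),
    (inferInstance : Module.Finite (DualNumber k) (LinearMap.range _))⟩
  -- the inclusion of `ε k[ε] ≅ k`
  let a : (vectorSpaces k).obj (ModuleCat.of k k) ⟶ K :=
    ObjectProperty.homMk (ModuleCat.ofHom
      (X := ((vectorSpaces k).obj (ModuleCat.of k k)).obj) (Y := DualNumber k)
      { toFun := fun c => TrivSqZeroExt.inr (R := k) (M := k) c
        map_add' := TrivSqZeroExt.inr_add k
        map_smul' := inr_fst_mul k })
  have ha : Mono a := by
    refine (finiteMultiplication (DualNumber.eps : DualNumber k)).ι.mono_of_mono_map ?_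
    exact (ModuleCat.mono_iff_injective _).2 TrivSqZeroExt.inr_injective
  have hrange : ∀ x : V, ι.hom.hom x ∈
      LinearMap.range (LinearMap.lsmul (DualNumber k) J.obj DualNumber.eps) := by
    intro x
    let b : ModuleCat.of k k ⟶ V := ModuleCat.ofHom (LinearMap.toSpanSingleton k _ x)
    let h : K ⟶ J := Injective.factorThru ((vectorSpaces k).map b ≫ ι) a
    have hh : a ≫ h = (vectorSpaces k).map b ≫ ι := Injective.comp_factorThru _ _
    have h₁ : h.hom.hom (DualNumber.eps : DualNumber k) = ι.hom.hom ((1 : k) • x) :=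
      congrArg (fun t : (vectorSpaces k).obj (ModuleCat.of k k) ⟶ J => t.hom.hom (1 : k)) hh
    rw [one_smul] at h₁
    refine ⟨h.hom.hom (1 : DualNumber k), ?_⟩
    rw [← h₁, LinearMap.lsmul_apply, ← map_smul]
    exact congrArg _ (mul_one _)
  have : Module.Finite (DualNumber k)
      (LinearMap.range (LinearMap.lsmul (DualNumber k) J.obj DualNumber.eps)) := J.property
  have : Module.Finite (DualNumber k) ((vectorSpaces k).obj V).obj :=
    Module.Finite.of_injective (ι.hom.hom.codRestrict _ hrange) fun x y hxy =>
      hι (congrArg Subtype.val hxy)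
  let σ : ((vectorSpaces k).obj V).obj →ₛₗ[dualNumberFst k] (ℕ →₀ k) :=
    { toFun := fun x => x
      map_add' := fun _ _ => rfl
      map_smul' := fun _ _ => rfl }
  have : RingHomSurjective (dualNumberFst k) := ⟨dualNumberFst_surjective k⟩
  have hfin : Module.Finite k (ℕ →₀ k) := Module.Finite.of_surjective σ fun x => ⟨x, rfl⟩
  exact not_finite_iff_infinite.2 (inferInstanceAs (Infinite ℕ))
    (Module.Finite.finite_basis (Finsupp.basisSingleOne (R := k) (ι := ℕ)))

end Counterexample

end AbelianDeformation

end

theorem theorem6p16 :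
    (∀ {R : Type v} {S : Type w} [CommRing R] [CommRing S] (θ : R →+* S)
        (_ : AbelianDeformation.IsNilpotentThickening θ)
        {C : Type u₁} [Category.{v} C] [Abelian C] [Linear R C]
        {D : Type u₂} [Category.{v₂} D] [Abelian D] [Linear S D]
        (F : D ⥤ C) (_ : AbelianDeformation.IsDeformation θ F)
        (_ : AbelianDeformation.IsFlat R C) (_ : EnoughInjectives D),
        EnoughInjectives C) ∧
    (∀ (k : Type v) [Field k],
        AbelianDeformation.IsNilpotentThickening (TrivSqZeroExt.fstHom k k k : DualNumber k →+* k) ∧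
        EnoughInjectives (ModuleCat.{v} k) ∧
        ∃ (C : Type (v + 1)) (_ : Category.{v} C) (_ : Abelian C) (_ : Linear (DualNumber k) C)
          (F : ModuleCat.{v} k ⥤ C),
          AbelianDeformation.IsDeformation (TrivSqZeroExt.fstHom k k k : DualNumber k →+* k) F ∧
          ¬ AbelianDeformation.IsFlat (DualNumber k) C ∧
          ¬ EnoughInjectives C) := by
  refine ⟨@fun R S _ _ θ hθ C _ _ _ D _ _ _ F hF hC _ =>
    AbelianDeformation.IsDeformation.enoughInjectives hθ hF hC, fun k _ =>
    ⟨AbelianDeformation.isNilpotentThickening_dualNumberFst k, inferInstance,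
      AbelianDeformation.FiniteEps k, inferInstance, inferInstance, inferInstance,
      AbelianDeformation.vectorSpaces k, AbelianDeformation.isDeformation_vectorSpaces k,
      fun hflat => ?_, AbelianDeformation.not_enoughInjectives_finiteEps k⟩⟩
  exact AbelianDeformation.not_enoughInjectives_finiteEps k
    (AbelianDeformation.IsDeformation.enoughInjectives
      (AbelianDeformation.isNilpotentThickening_dualNumberFst k)
      (AbelianDeformation.isDeformation_vectorSpaces k) hflat)
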